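/- Let $(B',g')$ and $(\widetilde B,\widetilde g)$ be non-empty smooth finite-dimensional pseudo-Riemannian manifolds without boundary (each may itself be a product of manifolds), and let $f':B'\to\mathbb R$ and $\widetilde f:\widetilde B\to\mathbb R$ be smooth functions such that $f(x,y)=f'(x)+\widetilde f(y)$ is positive on $B=B'\times\widetilde B$. Give $B$ the product metric $g=g'+\widetilde g$. Let $F=\mathbb R^d+E$ be a derived flat space, that is, $\mathbb R^d$ together with a smooth real vector bundle $E\to\mathbb R^d$ (the obstruction bundle). The virtual dimension of $F$ is $d-\operatorname{rank}E$, and all Riemannian quantities of $F$ are by definition those of $\mathbb R^d$ with the metric $(g_F)_{ij}=-\delta_{ij}$; for instance $\mathrm{Ric}_F$ is the Ricci tensor of $(\mathbb R^d,g_F)$. Let $\overline{\mathrm{Ric}}$ be the Ricci tensor of the warped product $B\times_f F$, i.e. of the metric $\bar g=g+f^2g_F$ on $B\times\mathbb R^d$. Let $\nabla^2$, $\nabla$ and $\Delta=\operatorname{tr}_g\nabla^2$ be the Hessian, gradient and Laplacian of $(B,g)$, and mark those of $B'$ and $\widetilde B$ with a prime and a tilde. Below, $X',Y'$ are tangent to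 $B'$, $\widetilde X,\widetilde Y$ to $\widetilde B$, $X$ to $B$, and $U,V$ to $\mathbb R^d$. (a) $\nabla^2f=\nabla'^2f'+\widetilde\nabla^2\widetilde f$ (pulled back to $B$), $|\nabla f|^2=|\nabla'f'|^2+|\widetilde\nabla\widetilde f|^2$ and $\Delta f=\Delta'f'+\widetilde\Delta\widetilde f$. (b) $\overline{\mathrm{Ric}}(X',Y')=\mathrm{Ric}'(X',Y')-\frac df\nabla'^2f'(X',Y')$, $\ \overline{\mathrm{Ric}}(X',\widetilde X)=0$ and $\overline{\mathrm{Ric}}(X,U)=0$. (c) Suppose $B\times_fF$ is a PNDP-manifold: $F$ has negative virtual dimension, equal to $-d$, and for some constant $\lambda$ both $\overline{\mathrm{Ric}}=\lambda\bar g$ and $\widetilde{\mathrm{Ric}}=\lambda\widetilde g$ (so $\widetilde B$ is Einstein with the same constant as the warped product). Then $\widetilde\nabla^2\widetilde f=0$. (d) Whenever $\widetilde\nabla^2\widetilde f=0$ (in particular for every PNDP-manifold), $\widetilde\Delta\widetilde f=0$ and $$\overline{\mathrm{Ric}}(\widetilde X,\widetilde Y)=\widetilde{\mathrm{Ric}}(\widetilde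 X,\widetilde Y),\qquad \overline{\mathrm{Ric}}(U,V)=\mathrm{Ric}_F(U,V)-f^2g_F(U,V)\,f^*,\qquad f^*=\frac{\Delta'f'}{f}+(d-1)\frac{|\nabla f|^2}{f^2}.$$ -/

import Mathlib

set_option maxSynthPendingDepth 3

open Set Bundle
open scoped Manifold ContDiff

noncomputable section

namespace WarpedRicci

/-! Pseudo-Riemannian geometry of a field of bilinear forms on an open part of a vector space -/

section VectorSpace

variable {E : Type*} [NormedAddCommGroup E] [NormedSpace ℝ E]

/-- The Christoffel symbols of the first kind of a metric `G` on a vector space, see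
`koszul_apply` for the formula. -/
def koszul (G : E → E →L[ℝ] E →L[ℝ] ℝ) (x : E) : E →L[ℝ] E →L[ℝ] (E →L[ℝ] ℝ) :=
  let D : E →L[ℝ] E →L[ℝ] (E →L[ℝ] ℝ) := fderiv ℝ G x
  let S : (E →L[ℝ] (E →L[ℝ] ℝ)) →L[ℝ] (E →L[ℝ] (E →L[ℝ] ℝ)) :=
    (ContinuousLinearMap.flipₗᵢ ℝ E E ℝ).toContinuousLinearEquiv.toContinuousLinearMap
  let T : E →L[ℝ] E →L[ℝ] (E →L[ℝ] ℝ) := S ∘L D.flip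
  (1 / 2 : ℝ) • (D + D.flip - T)

theorem koszul_apply (G : E → E →L[ℝ] E →L[ℝ] ℝ) (x u v w : E) :
    koszul G x u v w =
      (1 / 2 : ℝ) * (fderiv ℝ G x u v w + fderiv ℝ G x v u w - fderiv ℝ G x w u v) := by
  simp [koszul]

/-- The Christoffel symbols of the second kind (the Levi-Civita connection) of `G`: the vector
`Γ(u, v)` with `G(Γ(u, v), w) = koszul G x u v w`. -/
def christoffel (G : E → E →L[ℝ] E →L[ℝ] ℝ) (x : E) : E →L[ℝ] E →L[ℝ] E :=
  (ContinuousLinearMap.compL ℝ E (E →L[ℝ] ℝ) E (G x).inverse) ∘L (koszul G x)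

theorem christoffel_apply (G : E → E →L[ℝ] E →L[ℝ] ℝ) (x u v : E) :
    christoffel G x u v = (G x).inverse (koszul G x u v) := rfl

/-- The map `u ↦ R(u, v) w`, where `R(u, v) = [∇_u, ∇_v] - ∇_[u, v]` is the curvature of `G`. -/
def curvatureChart (G : E → E →L[ℝ] E →L[ℝ] ℝ) (x v w : E) : E →L[ℝ] E :=
  ((fderiv ℝ (christoffel G) x).flip v).flip w - (fderiv ℝ (christoffel G) x v).flip w
    + (christoffel G x).flip (christoffel G x v w)
    - (christoffel G x v) ∘L ((christoffel G x).flip w)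

theorem curvatureChart_apply (G : E → E →L[ℝ] E →L[ℝ] ℝ) (x u v w : E) :
    curvatureChart G x v w u =
      fderiv ℝ (christoffel G) x u v w - fderiv ℝ (christoffel G) x v u w
        + christoffel G x u (christoffel G x v w) - christoffel G x v (christoffel G x u w) := by
  simp [curvatureChart]

/-- The Ricci tensor `Ric(v, w) = tr (u ↦ R(u, v) w)`. -/
def ricciChart (G : E → E →L[ℝ] E →L[ℝ] ℝ) (x v w : E) : ℝ :=
  LinearMap.trace ℝ E (curvatureChart G x v w : E →ₗ[ℝ] E)

/-- The Hessian `∇²φ(u, v) = D²φ(u, v) - Dφ(Γ(u, v))`. -/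
def hessianChart (G : E → E →L[ℝ] E →L[ℝ] ℝ) (φ : E → ℝ) (x : E) : E →L[ℝ] E →L[ℝ] ℝ :=
  fderiv ℝ (fderiv ℝ φ) x
    - (ContinuousLinearMap.compL ℝ E E ℝ (fderiv ℝ φ x)) ∘L (christoffel G x)

theorem hessianChart_apply (G : E → E →L[ℝ] E →L[ℝ] ℝ) (φ : E → ℝ) (x u v : E) :
    hessianChart G φ x u v =
      fderiv ℝ (fderiv ℝ φ) x u v - fderiv ℝ φ x (christoffel G x u v) := rfl

end VectorSpace

/-! Manifolds -/

section Manifold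

variable {E : Type*} [NormedAddCommGroup E] [NormedSpace ℝ E] {H : Type*} [TopologicalSpace H]
  {I : ModelWithCorners ℝ E H} {M : Type*} [TopologicalSpace M] [ChartedSpace H M]

variable (I M) in
/-- A (not necessarily smooth) field of bilinear forms on the tangent spaces of `M`. -/
abbrev BilinearField : Type _ :=
  ∀ p : M, TangentSpace I p →L[ℝ] TangentSpace I p →L[ℝ] ℝ

/-- The field `g` written in the preferred chart at `p`: the pullback of `g` under the inverse of
the chart. In the tangent space `TangentSpace I p = E` of Mathlib the coordinates of a
tangent vector at `p` with respect to this chart are the vector itself, so that a tensor at `p` is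
given by its expression in this chart at the image of `p`. -/
def chartMetric (g : BilinearField I M) (p : M) (x : E) : E →L[ℝ] E →L[ℝ] ℝ :=
  let A : E →L[ℝ] E := mfderiv 𝓘(ℝ, E) I (extChartAt I p).symm x
  let G : E →L[ℝ] E →L[ℝ] ℝ := g ((extChartAt I p).symm x)
  G.bilinearComp A A

theorem chartMetric_apply (g : BilinearField I M) (p : M) (x u v : E) :
    chartMetric g p x u v = g ((extChartAt I p).symm x)
      (mfderiv 𝓘(ℝ, E) I (extChartAt I p).symm x u) (mfderiv 𝓘(ℝ, E) I (extChartAt I p).symm x v) := rfl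

/-- At `p` itself the pullback of `g` under the inverse of the chart is `g p`. -/
theorem chartMetric_self [IsManifold I ∞ M] [I.Boundaryless] (g : BilinearField I M) (p : M) (u v : TangentSpace I p) :
    chartMetric g p (extChartAt I p p) u v = g p u v := by
  have h3 : ∀ v : E, mfderiv 𝓘(ℝ, E) I (extChartAt I p).symm (extChartAt I p p) v = v := by
    intro v
    have hd : MDifferentiableAt 𝓘(ℝ, E) I (extChartAt I p).symm (extChartAt I p p) := by
      have := mdifferentiableWithinAt_extChartAt_symm (I := I) (x := p) (mem_extChartAt_target p)
      rwa [I.range_eq_univ, mdifferentiableWithinAt_univ] at this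
    rw [hd.mfderiv]
    have he : writtenInExtChartAt 𝓘(ℝ, E) I (extChartAt I p p) (extChartAt I p).symm
        =ᶠ[nhds (extChartAt I p p)] id := by
      filter_upwards [(isOpen_extChartAt_target (I := I) p).mem_nhds (mem_extChartAt_target p)] with y hy
      simp only [writtenInExtChartAt, extChartAt_model_space_eq_id, PartialEquiv.refl_symm, PartialEquiv.refl_coe, Function.comp, id, extChartAt_to_inv]
      exact (extChartAt I p).right_inv hy
    have h6 : range 𝓘(ℝ, E) = univ := by simp
    have := he.fderiv_eq (𝕜 := ℝ)
    have e2 := congrArg (fun T : E →L[ℝ] E => T v) this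
    simp only [fderiv_id] at e2
    rw [h6]
    exact (congrArg (fun T : E →L[ℝ] E => T v) (congrFun fderivWithin_univ _)).trans e2
  have e : ∀ q, q = p → ∀ a b : E, (g q : E →L[ℝ] E →L[ℝ] ℝ) a b = (g p : E →L[ℝ] E →L[ℝ] ℝ) a b := by
    rintro q rfl a b; rfl
  refine (chartMetric_apply g p _ u v).trans ?_
  refine (e _ (extChartAt_to_inv p) _ _).trans ?_
  exact congrArg₂ (fun a b : E => (g p : E →L[ℝ] E →L[ℝ] ℝ) a b) (h3 u) (h3 v)

/-- `g` is a pseudo-Riemannian metric: symmetric, nondegenerate and smooth. -/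
structure IsPseudoRiemannianMetric (g : BilinearField I M) : Prop where
  symm : ∀ (p : M) (u v : TangentSpace I p), g p u v = g p v u
  nondegenerate : ∀ (p : M) (u : TangentSpace I p), (∀ v, g p u v = 0) → u = 0
  smooth : ∀ p : M, ContDiffOn ℝ ∞ (chartMetric g p) (extChartAt I p).target

/-- The Ricci tensor of `g` at `p`. -/
def ricci (g : BilinearField I M) (p : M) (v w : TangentSpace I p) : ℝ :=
  ricciChart (chartMetric g p) (extChartAt I p p) v w

/-- The Hessian at `p` of a function, with respect to `g`. -/
def hessian (g : BilinearField I M) (φ : M → ℝ) (p : M) :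
    TangentSpace I p →L[ℝ] TangentSpace I p →L[ℝ] ℝ :=
  hessianChart (E := E) (chartMetric g p) (φ ∘ (extChartAt I p).symm) (extChartAt I p p)

/-- The gradient at `p` of a function: the vector with `g(∇φ, ·) = dφ`. -/
def gradient (g : BilinearField I M) (φ : M → ℝ) (p : M) : TangentSpace I p :=
  (g p).inverse (mfderiv I 𝓘(ℝ, ℝ) φ p : TangentSpace I p →L[ℝ] ℝ)

/-- The square `|∇φ|² = g(∇φ, ∇φ)` of the gradient. -/
def gradientSq (g : BilinearField I M) (φ : M → ℝ) (p : M) : ℝ :=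
  g p (gradient g φ p) (gradient g φ p)

/-- The Laplacian at `p` of a function: the `g`-trace of its Hessian. -/
def laplacian (g : BilinearField I M) (φ : M → ℝ) (p : M) : ℝ :=
  let G : E →L[ℝ] E →L[ℝ] ℝ := g p
  let h : E →L[ℝ] E →L[ℝ] ℝ := hessian g φ p
  LinearMap.trace ℝ E (G.inverse ∘L h : E →L[ℝ] E)

/-- `g` is an Einstein metric with constant `lam`. -/
def IsEinstein (g : BilinearField I M) (lam : ℝ) : Prop :=
  ∀ (p : M) (v w : TangentSpace I p), ricci g p v w = lam * g p v w

end Manifold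

/-! Products and warped products -/

section Product

variable {E₁ : Type*} [NormedAddCommGroup E₁] [NormedSpace ℝ E₁]
  {H₁ : Type*} [TopologicalSpace H₁] {I₁ : ModelWithCorners ℝ E₁ H₁}
  {M₁ : Type*} [TopologicalSpace M₁] [ChartedSpace H₁ M₁]
  {E₂ : Type*} [NormedAddCommGroup E₂] [NormedSpace ℝ E₂]
  {H₂ : Type*} [TopologicalSpace H₂] {I₂ : ModelWithCorners ℝ E₂ H₂}
  {M₂ : Type*} [TopologicalSpace M₂] [ChartedSpace H₂ M₂]

/-- The warped product metric `g + f² h` on `M₁ × M₂`, with `f` a function on `M₁`. -/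
def warpedProduct (g : BilinearField I₁ M₁) (f : M₁ → ℝ) (h : BilinearField I₂ M₂) :
    BilinearField (I₁.prod I₂) (M₁ × M₂) := fun p =>
  let G : E₁ →L[ℝ] E₁ →L[ℝ] ℝ := g p.1
  let K : E₂ →L[ℝ] E₂ →L[ℝ] ℝ := h p.2
  (G.bilinearComp (ContinuousLinearMap.fst ℝ E₁ E₂) (ContinuousLinearMap.fst ℝ E₁ E₂)
    + f p.1 ^ 2 •
      K.bilinearComp (ContinuousLinearMap.snd ℝ E₁ E₂) (ContinuousLinearMap.snd ℝ E₁ E₂) :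
    E₁ × E₂ →L[ℝ] E₁ × E₂ →L[ℝ] ℝ)

/-- The product metric `g + h` on `M₁ × M₂`. -/
def productMetric (g : BilinearField I₁ M₁) (h : BilinearField I₂ M₂) :
    BilinearField (I₁.prod I₂) (M₁ × M₂) :=
  warpedProduct g (fun _ => 1) h

theorem warpedProduct_apply (g : BilinearField I₁ M₁) (f : M₁ → ℝ) (h : BilinearField I₂ M₂)
    (p : M₁ × M₂) (u₁ v₁ : TangentSpace I₁ p.1) (u₂ v₂ : TangentSpace I₂ p.2) :
    warpedProduct g f h p (u₁, u₂) (v₁, v₂) = g p.1 u₁ v₁ + f p.1 ^ 2 * h p.2 u₂ v₂ := rfl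

theorem productMetric_apply (g : BilinearField I₁ M₁) (h : BilinearField I₂ M₂)
    (p : M₁ × M₂) (u₁ v₁ : TangentSpace I₁ p.1) (u₂ v₂ : TangentSpace I₂ p.2) :
    productMetric g h p (u₁, u₂) (v₁, v₂) = g p.1 u₁ v₁ + h p.2 u₂ v₂ := by
  simp [productMetric, warpedProduct_apply]

end Product

/-! Derived flat fibers -/

/-- The Euclidean space `ℝ^d`. -/
abbrev Eucl (d : ℕ) : Type := EuclideanSpace ℝ (Fin d)

/-- A derived flat space `F = ℝ^d + E`: the manifold `ℝ^d` together with a smooth real vector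
bundle `E` over it, the obstruction bundle. -/
structure DerivedFlat (d : ℕ) where
  rank : ℕ
  Obstruction : Eucl d → Type
  [topTotal : TopologicalSpace (TotalSpace (Eucl rank) Obstruction)]
  [topFiber : ∀ q, TopologicalSpace (Obstruction q)]
  [addCommGroup : ∀ q, AddCommGroup (Obstruction q)]
  [module : ∀ q, Module ℝ (Obstruction q)]
  [fiberBundle : FiberBundle (Eucl rank) Obstruction]
  [vectorBundle : VectorBundle ℝ (Eucl rank) Obstruction]
  [smoothBundle : ContMDiffVectorBundle ∞ (Eucl rank) Obstruction 𝓘(ℝ, Eucl d)]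

namespace DerivedFlat

variable {d : ℕ}

/-- The virtual dimension `d - rank E`. -/
def virtualDim (F : DerivedFlat d) : ℤ := (d : ℤ) - (F.rank : ℤ)

/-- The manifold on which the geometry of `F = ℝ^d + E` is computed, namely `ℝ^d`. -/
abbrev Underlying (_F : DerivedFlat d) : Type := Eucl d

/-- The flat metric `g_{ij} = -δ_{ij}` of `F = ℝ^d + E`. -/
def metric (F : DerivedFlat d) : BilinearField 𝓘(ℝ, Eucl d) F.Underlying :=
  fun _ => (-(innerSL ℝ) : Eucl d →L[ℝ] Eucl d →L[ℝ] ℝ)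

theorem metric_apply (F : DerivedFlat d) (q : F.Underlying) (u v : Eucl d) :
    F.metric q u v = -∑ i, u i * v i := by
  have h : F.metric q u v = -(inner ℝ u v) := rfl
  rw [h, PiLp.inner_apply]
  simp [mul_comm]

end DerivedFlat

section PNDP

variable {E₁ : Type*} [NormedAddCommGroup E₁] [NormedSpace ℝ E₁]
  {H₁ : Type*} [TopologicalSpace H₁] {I₁ : ModelWithCorners ℝ E₁ H₁}
  {B₁ : Type*} [TopologicalSpace B₁] [ChartedSpace H₁ B₁]
  {E₂ : Type*} [NormedAddCommGroup E₂] [NormedSpace ℝ E₂]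
  {H₂ : Type*} [TopologicalSpace H₂] {I₂ : ModelWithCorners ℝ E₂ H₂}
  {B₂ : Type*} [TopologicalSpace B₂] [ChartedSpace H₂ B₂] {d : ℕ}

/-- The sum `f(x, y) = f₁(x) + f₂(y)` on `B₁ × B₂`. -/
def splitSum (f₁ : B₁ → ℝ) (f₂ : B₂ → ℝ) (b : B₁ × B₂) : ℝ := f₁ b.1 + f₂ b.2

/-- The metric of `(B₁ × B₂) ×_f F` with `f = f₁ + f₂`, computed on `(B₁ × B₂) × ℝ^d`. -/
def totalMetric (g₁ : BilinearField I₁ B₁) (g₂ : BilinearField I₂ B₂)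
    (f₁ : B₁ → ℝ) (f₂ : B₂ → ℝ) (F : DerivedFlat d) :
    BilinearField ((I₁.prod I₂).prod 𝓘(ℝ, Eucl d)) ((B₁ × B₂) × F.Underlying) :=
  warpedProduct (productMetric g₁ g₂) (splitSum f₁ f₂) F.metric

/-- `(B₁ × B₂) ×_f F` is a PNDP-manifold with constant `lam`: the fiber has negative virtual
dimension `-d`, the whole warped product is Einstein with constant `lam`, and so is `B₂`. -/
structure IsPNDP (g₁ : BilinearField I₁ B₁) (g₂ : BilinearField I₂ B₂)
    (f₁ : B₁ → ℝ) (f₂ : B₂ → ℝ) (F : DerivedFlat d) (lam : ℝ) : Prop where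
  virtualDim_neg : F.virtualDim < 0
  virtualDim_eq : F.virtualDim = -(d : ℤ)
  einstein_total : IsEinstein (totalMetric g₁ g₂ f₁ f₂ F) lam
  einstein_second : IsEinstein g₂ lam

end PNDP

end WarpedRicci

end

/-! Ricci, Hessian, gradient and Laplacian at a point depend only on the germ of the metric and of
the function in one chart. The preferred chart of a product is the product of the preferred charts.
A warped product therefore becomes, near the image of the point, a warped product `G + φ² K` of
metrics on two vector spaces, and everything reduces to calculus there.

In the chart the connection is found by writing down the expected formula (`warpedConnection`) and
pairing it with an arbitrary vector: by nondegeneracy the Koszul formula determines the Christoffel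
symbols (`christoffel_warpedChart`). Since Ricci is a trace, only the two diagonal blocks of `u ↦
R(u, V) W` are needed. The base block contains the curvature of `G` and the endomorphism `∇ grad φ`;
the fiber block contains the curvature of `K`, a multiple of the identity and a rank-one term. Their
traces give `ricciChart_warpedChart`, with `n = dim E₂`: Ric(V, W) = Ric_G(V₁, W₁) - (n/φ) ∇²φ(V₁,
W₁) + Ric_K(V₂, W₂) - K(V₂, W₂) (φ Δφ + (n - 1)|∇φ|²).

This one formula is used twice. With `φ = 1` it handles the base `B₁ × B₂`, where Hessian, gradient
and Laplacian of a sum also split. With `φ = f₁ + f₂` it attaches the fiber `ℝ^d`. All Ricci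
statements are evaluations of the result on blocks. For a PNDP-manifold the second block reads `lam
g₂ = lam g₂ - (d/f) ∇²f₂`; negativity of the virtual dimension `-d` makes `d` nonzero, so the
Hessian of `f₂` vanishes. -/

namespace WarpedRicci

open Filter Topology ContinuousLinearMap


/-! ### Levi-Civita calculus of a metric on a vector space -/

section VectorSpace

variable {E : Type*} [NormedAddCommGroup E] [NormedSpace ℝ E]

theorem hasFDerivAt_apply₂ {X V W Z : Type*} [NormedAddCommGroup X] [NormedSpace ℝ X]
    [NormedAddCommGroup V] [NormedSpace ℝ V] [NormedAddCommGroup W] [NormedSpace ℝ W]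
    [NormedAddCommGroup Z] [NormedSpace ℝ Z] {G : X → V →L[ℝ] W →L[ℝ] Z} {x : X}
    (hG : DifferentiableAt ℝ G x) (v : V) (w : W) :
    HasFDerivAt (fun y => G y v w) (((fderiv ℝ G x).flip v).flip w) x := by
  have h1 := hG.hasFDerivAt.clm_apply (hasFDerivAt_const v x)
  have h2 := h1.clm_apply (hasFDerivAt_const w x)
  refine h2.congr_fderiv ?_
  ext u
  simp

/-- `G` is a pseudo-Riemannian metric of class `C²` near `x`. -/
structure IsMetricAt (G : E → E →L[ℝ] E →L[ℝ] ℝ) (x : E) : Prop where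
  contDiffAt : ContDiffAt ℝ 2 G x
  symm : ∀ᶠ y in 𝓝 x, ∀ u v, G y u v = G y v u
  invertible : (G x).IsInvertible

namespace IsMetricAt

variable {G : E → E →L[ℝ] E →L[ℝ] ℝ} {x : E}

theorem congr {G' : E → E →L[ℝ] E →L[ℝ] ℝ} (h : IsMetricAt G x) (e : G' =ᶠ[𝓝 x] G) :
    IsMetricAt G' x where
  contDiffAt := h.contDiffAt.congr_of_eventuallyEq e
  symm := by
    filter_upwards [h.symm, e] with y hy ey
    simpa [ey] using hy
  invertible := by rw [e.self_of_nhds]; exact h.invertible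

theorem differentiableAt (h : IsMetricAt G x) : DifferentiableAt ℝ G x :=
  h.contDiffAt.differentiableAt (by norm_num)

theorem apply_comm (h : IsMetricAt G x) (u v : E) : G x u v = G x v u :=
  h.symm.self_of_nhds u v

/-- Nondegeneracy as an extensionality principle: identities between vectors, such as formulas for
Christoffel symbols, are proved by pairing with a test vector. -/
theorem ext (h : IsMetricAt G x) {u v : E} (e : ∀ w, G x u w = G x v w) : u = v :=
  h.invertible.injective (ContinuousLinearMap.ext e)

theorem apply_inverse (h : IsMetricAt G x) (φ : E →L[ℝ] ℝ) (w : E) :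
    G x ((G x).inverse φ) w = φ w := by
  rw [h.invertible.self_apply_inverse]

/-- Symmetry is assumed on a neighbourhood precisely so that it can be differentiated. -/
theorem fderiv_symm (h : IsMetricAt G x) (u v w : E) :
    fderiv ℝ G x u v w = fderiv ℝ G x u w v := by
  have e : (fun y => G y v w) =ᶠ[𝓝 x] fun y => G y w v := by
    filter_upwards [h.symm] with y hy using hy v w
  have := (hasFDerivAt_apply₂ h.differentiableAt v w).fderiv.symm.trans
    (e.fderiv_eq.trans (hasFDerivAt_apply₂ h.differentiableAt w v).fderiv)
  simpa using congrArg (fun T : E →L[ℝ] ℝ => T u) this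

theorem apply_christoffel (h : IsMetricAt G x) (u v w : E) :
    G x (christoffel G x u v) w =
      (1 / 2 : ℝ) * (fderiv ℝ G x u v w + fderiv ℝ G x v u w - fderiv ℝ G x w u v) := by
  rw [christoffel_apply, h.apply_inverse, koszul_apply]

theorem christoffel_comm (h : IsMetricAt G x) (u v : E) :
    christoffel G x u v = christoffel G x v u :=
  h.ext fun w => by
    rw [h.apply_christoffel, h.apply_christoffel, h.fderiv_symm w u v]; ring

/-- Compatibility of the connection with the metric, `∇G = 0`: in the sum of the two Koszul
expressions the remaining derivatives cancel in pairs. -/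
theorem fderiv_eq_christoffel (h : IsMetricAt G x) (u v w : E) :
    fderiv ℝ G x u v w = G x (christoffel G x u v) w + G x v (christoffel G x u w) := by
  rw [h.apply_comm v, h.apply_christoffel, h.apply_christoffel, h.fderiv_symm u w v]
  ring

variable [CompleteSpace E]

/-- Invertible operators form an open set when `E` is complete, so invertibility at `x` spreads to
nearby points. This lets pointwise connection formulas be differentiated. -/
theorem eventually (h : IsMetricAt G x) : ∀ᶠ y in 𝓝 x, IsMetricAt G y := by
  obtain ⟨e, he⟩ := h.invertible
  have h1 : ∀ᶠ y in 𝓝 x, (G y).IsInvertible := by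
    have := h.differentiableAt.continuousAt.eventually_mem
      (s := range ((↑) : (E ≃L[ℝ] (E →L[ℝ] ℝ)) → E →L[ℝ] E →L[ℝ] ℝ))
      (by rw [← he]; exact ContinuousLinearEquiv.nhds e)
    exact this
  filter_upwards [h.contDiffAt.eventually (by simp), eventually_eventually_nhds.2 h.symm, h1]
    with y a b c using ⟨a, b, c⟩

theorem contDiffAt_inverse (h : IsMetricAt G x) : ContDiffAt ℝ 2 (fun y => (G y).inverse) x := by
  obtain ⟨e, he⟩ := h.invertible
  have h1 : ContDiffAt ℝ 2 inverse (G x) := by rw [← he]; exact contDiffAt_map_inverse e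
  exact h1.comp x h.contDiffAt

theorem differentiableAt_christoffel (h : IsMetricAt G x) :
    DifferentiableAt ℝ (christoffel G) x := by
  have hD : DifferentiableAt ℝ (fderiv ℝ G) x :=
    (h.contDiffAt.fderiv_right (m := 1) (by norm_num)).differentiableAt (by norm_num)
  have hi := h.contDiffAt_inverse.differentiableAt (by norm_num)
  have hflip : DifferentiableAt ℝ (fun y => (fderiv ℝ G y).flip) x :=
    (ContinuousLinearMap.flipₗᵢ ℝ E E (E →L[ℝ] ℝ)).toContinuousLinearEquiv.differentiableAt.comp
      x hD
  have hk : DifferentiableAt ℝ (koszul G) x := by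
    unfold koszul
    exact ((hD.add hflip).sub ((differentiableAt_const _).clm_comp hflip)).const_smul (1 / 2 : ℝ)
  unfold christoffel
  exact ((ContinuousLinearMap.compL ℝ E (E →L[ℝ] ℝ) E).differentiableAt.comp x hi).clm_comp hk

end IsMetricAt

theorem christoffel_congr {G G' : E → E →L[ℝ] E →L[ℝ] ℝ} {x : E} (h : G =ᶠ[𝓝 x] G') :
    christoffel G x = christoffel G' x := by
  simp only [christoffel, koszul, h.fderiv_eq, h.self_of_nhds]

/-- Curvature differentiates the Christoffel symbols, so these must agree near `x` and not only at
`x`. -/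
theorem ricciChart_congr {G G' : E → E →L[ℝ] E →L[ℝ] ℝ} {x : E} (h : G =ᶠ[𝓝 x] G') (v w : E) :
    ricciChart G x v w = ricciChart G' x v w := by
  have e : christoffel G =ᶠ[𝓝 x] christoffel G' := by
    filter_upwards [eventually_eventually_nhds.2 h] with y hy using christoffel_congr hy
  simp only [ricciChart, curvatureChart, e.fderiv_eq, e.self_of_nhds]

theorem hessianChart_congr {G G' : E → E →L[ℝ] E →L[ℝ] ℝ} {x : E} (h : G =ᶠ[𝓝 x] G')
    (φ : E → ℝ) : hessianChart G φ x = hessianChart G' φ x := by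
  simp only [hessianChart, christoffel_congr h]

theorem ricciChart_zero_left (G : E → E →L[ℝ] E →L[ℝ] ℝ) (x w : E) : ricciChart G x 0 w = 0 := by
  have : curvatureChart G x 0 w = 0 := by ext u; simp [curvatureChart_apply]
  simp [ricciChart, this]

theorem ricciChart_zero_right (G : E → E →L[ℝ] E →L[ℝ] ℝ) (x v : E) : ricciChart G x v 0 = 0 := by
  have : curvatureChart G x v 0 = 0 := by ext u; simp [curvatureChart_apply]
  simp [ricciChart, this]

/-- The gradient of a function on a vector space with metric `G`. -/
noncomputable def gradientChart (G : E → E →L[ℝ] E →L[ℝ] ℝ) (φ : E → ℝ) (x : E) : E :=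
  (G x).inverse (fderiv ℝ φ x)

/-- The Laplacian of a function on a vector space with metric `G`. -/
noncomputable def laplacianChart (G : E → E →L[ℝ] E →L[ℝ] ℝ) (φ : E → ℝ) (x : E) : ℝ :=
  LinearMap.trace ℝ E ((G x).inverse ∘L hessianChart G φ x : E →L[ℝ] E)

/-- With an index raised, the Hessian is the covariant derivative `∇_u grad φ`. This follows by
differentiating `G(grad φ, w) = dφ(w)` in the direction `u` and using metric compatibility. The
right-hand side is the form in which the Hessian appears in the curvature of a warped product. -/
theorem IsMetricAt.inverse_hessianChart [CompleteSpace E] {G : E → E →L[ℝ] E →L[ℝ] ℝ} {φ : E → ℝ}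
    {x : E} (h : IsMetricAt G x) (hφ : ContDiffAt ℝ 2 φ x) (u : E) :
    (G x).inverse (hessianChart G φ x u) =
      fderiv ℝ (gradientChart G φ) x u + christoffel G x u (gradientChart G φ x) := by
  refine h.ext fun w => ?_
  have hDφ : DifferentiableAt ℝ (fderiv ℝ φ) x :=
    (hφ.fderiv_right (m := 1) (by norm_num)).differentiableAt (by norm_num)
  have hn : DifferentiableAt ℝ (gradientChart G φ) x :=
    (h.contDiffAt_inverse.differentiableAt (by norm_num)).clm_apply hDφ
  have e : (fun y => G y (gradientChart G φ y) w) =ᶠ[𝓝 x] fun y => fderiv ℝ φ y w := by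
    filter_upwards [h.eventually] with y hy using hy.apply_inverse _ _
  have h1 := ((h.differentiableAt.hasFDerivAt.clm_apply hn.hasFDerivAt).clm_apply
    (hasFDerivAt_const w x)).fderiv
  have h2 := (hDφ.hasFDerivAt.clm_apply (hasFDerivAt_const w x)).fderiv
  have h3 := congrArg (fun T : E →L[ℝ] ℝ => T u) (h1.symm.trans (e.fderiv_eq.trans h2))
  simp only [add_apply, comp_apply, flip_apply, zero_apply, map_zero, zero_add] at h3
  rw [h.apply_inverse, hessianChart_apply, ← h3, ← h.apply_inverse (fderiv ℝ φ x)]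
  rw [h.fderiv_eq_christoffel, map_add, add_apply]
  simp only [gradientChart]
  ring

end VectorSpace


/-! ### Warped products of vector spaces: inverse metric and connection -/

section WarpedVectorSpace

/-- By cyclicity of the trace the two terms are traces of `T` composed with the two coordinate
projectors, which add up to the identity. -/
theorem trace_prod {E₁ E₂ : Type*} [AddCommGroup E₁] [Module ℝ E₁] [FiniteDimensional ℝ E₁]
    [AddCommGroup E₂] [Module ℝ E₂] [FiniteDimensional ℝ E₂] (T : E₁ × E₂ →ₗ[ℝ] E₁ × E₂) :
    LinearMap.trace ℝ (E₁ × E₂) T =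
      LinearMap.trace ℝ E₁ (LinearMap.fst ℝ E₁ E₂ ∘ₗ T ∘ₗ LinearMap.inl ℝ E₁ E₂) +
      LinearMap.trace ℝ E₂ (LinearMap.snd ℝ E₁ E₂ ∘ₗ T ∘ₗ LinearMap.inr ℝ E₁ E₂) := by
  rw [LinearMap.trace_comp_comm' (T ∘ₗ LinearMap.inl ℝ E₁ E₂) (LinearMap.fst ℝ E₁ E₂),
    LinearMap.trace_comp_comm' (T ∘ₗ LinearMap.inr ℝ E₁ E₂) (LinearMap.snd ℝ E₁ E₂), ← map_add]
  congr 1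
  ext p <;> simp [← Prod.zero_eq_mk]

variable {E₁ : Type*} [NormedAddCommGroup E₁] [NormedSpace ℝ E₁]
  {E₂ : Type*} [NormedAddCommGroup E₂] [NormedSpace ℝ E₂]

/-- The warped product `G + φ² K` of metrics on two vector spaces. -/
noncomputable def warpedChart (G : E₁ → E₁ →L[ℝ] E₁ →L[ℝ] ℝ) (φ : E₁ → ℝ)
    (K : E₂ → E₂ →L[ℝ] E₂ →L[ℝ] ℝ) (p : E₁ × E₂) : E₁ × E₂ →L[ℝ] E₁ × E₂ →L[ℝ] ℝ :=
  (G p.1).bilinearComp (ContinuousLinearMap.fst ℝ E₁ E₂) (ContinuousLinearMap.fst ℝ E₁ E₂)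
    + φ p.1 ^ 2 •
      (K p.2).bilinearComp (ContinuousLinearMap.snd ℝ E₁ E₂) (ContinuousLinearMap.snd ℝ E₁ E₂)

variable {G : E₁ → E₁ →L[ℝ] E₁ →L[ℝ] ℝ} {φ : E₁ → ℝ} {K : E₂ → E₂ →L[ℝ] E₂ →L[ℝ] ℝ}

theorem warpedChart_apply (p U V : E₁ × E₂) :
    warpedChart G φ K p U V = G p.1 U.1 V.1 + φ p.1 ^ 2 * K p.2 U.2 V.2 := rfl

theorem _root_.ContDiffAt.bilinearComp {X V W : Type*} [NormedAddCommGroup X] [NormedSpace ℝ X]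
    [NormedAddCommGroup V] [NormedSpace ℝ V] [NormedAddCommGroup W] [NormedSpace ℝ W]
    {n : WithTop ℕ∞} {B : X → V →L[ℝ] V →L[ℝ] ℝ} {x : X} (hB : ContDiffAt ℝ n B x) (A : W →L[ℝ] V) :
    ContDiffAt ℝ n (fun y => (B y).bilinearComp A A) x := by
  have h1 : ContDiffAt ℝ n (fun y => (B y ∘L A).flip) x :=
    (ContinuousLinearMap.flipₗᵢ ℝ W V ℝ).toContinuousLinearEquiv.contDiff.contDiffAt.comp x
      (hB.clm_comp contDiffAt_const)
  exact (ContinuousLinearMap.flipₗᵢ ℝ W W ℝ).toContinuousLinearEquiv.contDiff.contDiffAt.comp x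
    (h1.clm_comp contDiffAt_const)

variable {p : E₁ × E₂}

/-- The metric is block diagonal, so the candidate `N` inverts each block separately; it is checked
to be a two-sided inverse. -/
theorem warpedChart_inverse_apply (hG : (G p.1).IsInvertible) (hK : (K p.2).IsInvertible)
    (hφ : φ p.1 ≠ 0) (α : E₁ × E₂ →L[ℝ] ℝ) :
    (warpedChart G φ K p).IsInvertible ∧ (warpedChart G φ K p).inverse α =
      ((G p.1).inverse (α ∘L inl ℝ E₁ E₂), (φ p.1 ^ 2)⁻¹ • (K p.2).inverse (α ∘L inr ℝ E₁ E₂)) := by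
  let N : (E₁ × E₂ →L[ℝ] ℝ) →L[ℝ] E₁ × E₂ :=
    ((G p.1).inverse ∘L (ContinuousLinearMap.compL ℝ E₁ (E₁ × E₂) ℝ).flip (inl ℝ E₁ E₂)).prod
      ((φ p.1 ^ 2)⁻¹ • ((K p.2).inverse ∘L
        (ContinuousLinearMap.compL ℝ E₂ (E₁ × E₂) ℝ).flip (inr ℝ E₁ E₂)))
  have hN : ∀ α, N α = ((G p.1).inverse (α ∘L inl ℝ E₁ E₂),
      (φ p.1 ^ 2)⁻¹ • (K p.2).inverse (α ∘L inr ℝ E₁ E₂)) := fun _ => rfl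
  have h1 : warpedChart G φ K p ∘L N = .id ℝ _ := by
    ext α w
    · simp [hN, warpedChart_apply, hG.self_apply_inverse]
    · simp [hN, warpedChart_apply, hK.self_apply_inverse, hφ]
  have e1 : ∀ U, warpedChart G φ K p U ∘L inl ℝ E₁ E₂ = G p.1 U.1 := fun U => by
    ext; simp [warpedChart_apply]
  have e2 : ∀ U, warpedChart G φ K p U ∘L inr ℝ E₁ E₂ = φ p.1 ^ 2 • K p.2 U.2 := fun U => by
    ext; simp [warpedChart_apply]
  have h2 : N ∘L warpedChart G φ K p = .id ℝ _ := by
    refine ContinuousLinearMap.ext fun U => ?_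
    rw [comp_apply, hN, e1, e2, map_smul, hG.inverse_apply_self, hK.inverse_apply_self,
      inv_smul_smul₀ (pow_ne_zero 2 hφ)]
    rfl
  exact ⟨.of_inverse h1 h2, by rw [ContinuousLinearMap.inverse_eq h1 h2, hN]⟩

theorem IsMetricAt.warpedChart (hG : IsMetricAt G p.1) (hφ : ContDiffAt ℝ 2 φ p.1)
    (hφ0 : φ p.1 ≠ 0) (hK : IsMetricAt K p.2) : IsMetricAt (warpedChart G φ K) p where
  contDiffAt := by
    have h1 : ContDiffAt ℝ 2 (fun q : E₁ × E₂ => G q.1) p := hG.contDiffAt.comp p contDiffAt_fst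
    have h2 : ContDiffAt ℝ 2 (fun q : E₁ × E₂ => K q.2) p := hK.contDiffAt.comp p contDiffAt_snd
    have h3 : ContDiffAt ℝ 2 (fun q : E₁ × E₂ => φ q.1) p := hφ.comp p contDiffAt_fst
    exact (h1.bilinearComp _).add ((h3.pow 2).smul (h2.bilinearComp _))
  symm := by
    have h1 := (continuous_fst.tendsto p).eventually hG.symm
    have h2 := (continuous_snd.tendsto p).eventually hK.symm
    filter_upwards [h1, h2] with q a b U V
    rw [warpedChart_apply, warpedChart_apply, a, b]
  invertible := (warpedChart_inverse_apply hG.invertible hK.invertible hφ0 0).1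

theorem fderiv_warpedChart (hG : DifferentiableAt ℝ G p.1) (hφ : DifferentiableAt ℝ φ p.1)
    (hK : DifferentiableAt ℝ K p.2) (hW : DifferentiableAt ℝ (warpedChart G φ K) p)
    (U V W : E₁ × E₂) :
    fderiv ℝ (warpedChart G φ K) p U V W = fderiv ℝ G p.1 U.1 V.1 W.1
      + 2 * φ p.1 * fderiv ℝ φ p.1 U.1 * K p.2 V.2 W.2
      + φ p.1 ^ 2 * fderiv ℝ K p.2 U.2 V.2 W.2 := by
  have h1 := (hasFDerivAt_apply₂ hG V.1 W.1).comp p hasFDerivAt_fst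
  have h2 := (hasFDerivAt_apply₂ hK V.2 W.2).comp p hasFDerivAt_snd
  have h3 := (hφ.hasFDerivAt.comp p hasFDerivAt_fst).pow 2
  have h4 := congrArg (fun T : E₁ × E₂ →L[ℝ] ℝ => T U)
    ((hasFDerivAt_apply₂ hW V W).unique (h1.add (h3.mul h2)))
  simp at h4
  rw [h4]
  ring

variable (G φ K p) in
/-- The Levi-Civita connection of the warped product. -/
noncomputable def warpedConnection (V W : E₁ × E₂) : E₁ × E₂ :=
  (christoffel G p.1 V.1 W.1 - (φ p.1 * K p.2 V.2 W.2) • gradientChart G φ p.1,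
    christoffel K p.2 V.2 W.2 + (fderiv ℝ φ p.1 V.1 / φ p.1) • W.2
      + (fderiv ℝ φ p.1 W.1 / φ p.1) • V.2)

/-- Both sides have the same pairing with every `Z`. In the Koszul formula the derivative of `φ²`
contributes `2 φ dφ` three times: once with direction `Z`, giving the gradient term, and once each
with directions `V` and `W`, giving the terms in `dφ / φ`. -/
theorem christoffel_warpedChart (hG : IsMetricAt G p.1) (hφ : ContDiffAt ℝ 2 φ p.1)
    (hφ0 : φ p.1 ≠ 0) (hK : IsMetricAt K p.2) (V W : E₁ × E₂) :
    christoffel (warpedChart G φ K) p V W = warpedConnection G φ K p V W := by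
  have hW := hG.warpedChart hφ hφ0 hK
  have hd := fderiv_warpedChart hG.differentiableAt (hφ.differentiableAt (by norm_num))
    hK.differentiableAt hW.differentiableAt
  refine hW.ext fun Z => ?_
  rw [hW.apply_christoffel, hd, hd, hd, warpedChart_apply, warpedConnection]
  simp only [map_sub, map_add, map_smul, sub_apply, add_apply, smul_apply, smul_eq_mul,
    gradientChart, hG.apply_inverse, hG.apply_christoffel, hK.apply_christoffel]
  rw [hK.apply_comm W.2 Z.2, hK.apply_comm V.2 Z.2]
  field_simp
  ring

end WarpedVectorSpace


/-! ### Curvature and Ricci tensor of a warped product -/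

section WarpedCurvature

variable {E₁ : Type*} [NormedAddCommGroup E₁] [NormedSpace ℝ E₁]
  {E₂ : Type*} [NormedAddCommGroup E₂] [NormedSpace ℝ E₂]
  {G : E₁ → E₁ →L[ℝ] E₁ →L[ℝ] ℝ} {φ : E₁ → ℝ} {K : E₂ → E₂ →L[ℝ] E₂ →L[ℝ] ℝ} {p : E₁ × E₂}

theorem eventually_christoffel_warpedChart [CompleteSpace E₁] [CompleteSpace E₂]
    (hG : IsMetricAt G p.1) (hφ : ContDiffAt ℝ 2 φ p.1)
    (hφ0 : φ p.1 ≠ 0) (hK : IsMetricAt K p.2) :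
    ∀ᶠ q in 𝓝 p, ∀ V W, christoffel (warpedChart G φ K) q V W = warpedConnection G φ K q V W := by
  have h1 := (continuous_fst.tendsto p).eventually hG.eventually
  have h2 := (continuous_snd.tendsto p).eventually hK.eventually
  have h3 := (continuous_fst.tendsto p).eventually (hφ.eventually (by simp))
  have h4 := (continuous_fst.tendsto p).eventually (hφ.continuousAt.eventually_ne hφ0)
  filter_upwards [h1, h2, h3, h4] with q a b c d V W using christoffel_warpedChart a c d b V W

theorem fderiv_christoffel_warpedChart [CompleteSpace E₁] [CompleteSpace E₂]
    (hG : IsMetricAt G p.1) (hφ : ContDiffAt ℝ 2 φ p.1)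
    (hφ0 : φ p.1 ≠ 0) (hK : IsMetricAt K p.2) (U V W : E₁ × E₂) :
    fderiv ℝ (christoffel (warpedChart G φ K)) p U V W =
      (fderiv ℝ (christoffel G) p.1 U.1 V.1 W.1
          - ((φ p.1 * K p.2 V.2 W.2) • fderiv ℝ (gradientChart G φ) p.1 U.1
            + (φ p.1 * fderiv ℝ K p.2 U.2 V.2 W.2 + K p.2 V.2 W.2 * fderiv ℝ φ p.1 U.1)
              • gradientChart G φ p.1),
        fderiv ℝ (christoffel K) p.2 U.2 V.2 W.2
          + (fderiv ℝ (fderiv ℝ φ) p.1 U.1 V.1 / φ p.1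
              - fderiv ℝ φ p.1 V.1 * fderiv ℝ φ p.1 U.1 / φ p.1 ^ 2) • W.2
          + (fderiv ℝ (fderiv ℝ φ) p.1 U.1 W.1 / φ p.1
              - fderiv ℝ φ p.1 W.1 * fderiv ℝ φ p.1 U.1 / φ p.1 ^ 2) • V.2) := by
  have hW := hG.warpedChart hφ hφ0 hK
  have hDφ : DifferentiableAt ℝ (fderiv ℝ φ) p.1 :=
    (hφ.fderiv_right (m := 1) (by norm_num)).differentiableAt (by norm_num)
  have hn : DifferentiableAt ℝ (gradientChart G φ) p.1 :=
    (hG.contDiffAt_inverse.differentiableAt (by norm_num)).clm_apply hDφ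
  have hφ1 : HasFDerivAt φ (fderiv ℝ φ p.1) p.1 :=
    (hφ.differentiableAt (by norm_num)).hasFDerivAt
  -- The connection formula holds on a neighbourhood of `p`, so its derivative may be computed from
  -- the right-hand side.
  have e : (fun q => christoffel (warpedChart G φ K) q V W) =ᶠ[𝓝 p]
      fun q => warpedConnection G φ K q V W := by
    filter_upwards [eventually_christoffel_warpedChart hG hφ hφ0 hK] with q hq using hq V W
  -- Quotient rule for the logarithmic derivative of `φ`.
  have hρ (v : E₁) : HasFDerivAt (fun x => fderiv ℝ φ x v / φ x)
      ((φ p.1)⁻¹ • (fderiv ℝ (fderiv ℝ φ) p.1).flip v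
        - (fderiv ℝ φ p.1 v / φ p.1 ^ 2) • fderiv ℝ φ p.1) p.1 := by
    have h := (hDφ.hasFDerivAt.clm_apply (hasFDerivAt_const v p.1)).mul
      ((hasDerivAt_inv hφ0).comp_hasFDerivAt p.1 hφ1)
    refine (h.congr_fderiv ?_).congr_of_eventuallyEq (.of_forall fun x => div_eq_mul_inv _ _)
    ext u
    simp
    ring
  have h1 := (hasFDerivAt_apply₂ hG.differentiableAt_christoffel V.1 W.1).comp p hasFDerivAt_fst
  have h2 := (hφ1.comp p hasFDerivAt_fst).mul
    ((hasFDerivAt_apply₂ hK.differentiableAt V.2 W.2).comp p hasFDerivAt_snd)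
  have h3 := h2.smul (hn.hasFDerivAt.comp p hasFDerivAt_fst)
  have h4 := (hasFDerivAt_apply₂ hK.differentiableAt_christoffel V.2 W.2).comp p hasFDerivAt_snd
  have h5 := ((hρ V.1).comp p hasFDerivAt_fst).smul_const W.2
  have h6 := ((hρ W.1).comp p hasFDerivAt_fst).smul_const V.2
  have h7 := (h1.sub h3).prodMk ((h4.add h5).add h6)
  have h8 := (hasFDerivAt_apply₂ hW.differentiableAt_christoffel V W).unique
    (h7.congr_of_eventuallyEq e)
  refine (congrArg (fun T : E₁ × E₂ →L[ℝ] E₁ × E₂ => T U) h8).trans ?_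
  refine Prod.ext ?_ ?_
  · simp
  · simp
    match_scalars <;> field_simp

/-- The base diagonal block. The terms containing `K` combine into a multiple of `∇_u grad φ`, which
is the Hessian with an index raised. -/
theorem curvatureChart_warpedChart_fst [CompleteSpace E₁] [CompleteSpace E₂]
    (hG : IsMetricAt G p.1) (hφ : ContDiffAt ℝ 2 φ p.1)
    (hφ0 : φ p.1 ≠ 0) (hK : IsMetricAt K p.2) (V W : E₁ × E₂) (u : E₁) :
    (curvatureChart (warpedChart G φ K) p V W (u, 0)).1 = curvatureChart G p.1 V.1 W.1 u
      - (φ p.1 * K p.2 V.2 W.2) • (G p.1).inverse (hessianChart G φ p.1 u) := by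
  rw [hG.inverse_hessianChart hφ]
  simp only [curvatureChart_apply, fderiv_christoffel_warpedChart hG hφ hφ0 hK,
    christoffel_warpedChart hG hφ hφ0 hK, warpedConnection, map_zero, zero_apply, mul_zero, smul_zero,
    zero_smul, sub_zero, add_zero, zero_add, Prod.fst_add, Prod.fst_sub, map_sub, map_smul,
    map_add, smul_eq_mul, gradientChart]
  match_scalars <;> field_simp
  ring

/-- The fiber diagonal block. Symmetry of the connection of `K` cancels the terms mixing it with
`dφ`; the last term has the shape of constant curvature, with factor `|∇φ|²`. -/
theorem curvatureChart_warpedChart_snd [CompleteSpace E₁] [CompleteSpace E₂]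
    (hG : IsMetricAt G p.1) (hφ : ContDiffAt ℝ 2 φ p.1)
    (hφ0 : φ p.1 ≠ 0) (hK : IsMetricAt K p.2) (V W : E₁ × E₂) (a : E₂) :
    (curvatureChart (warpedChart G φ K) p V W (0, a)).2 = curvatureChart K p.2 V.2 W.2 a
      - (hessianChart G φ p.1 V.1 W.1 / φ p.1) • a
      - fderiv ℝ φ p.1 (gradientChart G φ p.1) • (K p.2 V.2 W.2 • a - K p.2 a W.2 • V.2) := by
  simp only [curvatureChart_apply, fderiv_christoffel_warpedChart hG hφ hφ0 hK, hessianChart_apply,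
    christoffel_warpedChart hG hφ hφ0 hK, warpedConnection, map_zero, zero_apply, mul_zero, smul_zero,
    zero_smul, sub_zero, add_zero, zero_add, Prod.snd_add, Prod.snd_sub, map_sub, map_smul, zero_sub,
    map_add, smul_eq_mul, zero_div, map_neg, hK.christoffel_comm V.2 a]
  match_scalars <;> field_simp <;> ring

theorem ricciChart_warpedChart [FiniteDimensional ℝ E₁] [FiniteDimensional ℝ E₂]
    (hG : IsMetricAt G p.1) (hφ : ContDiffAt ℝ 2 φ p.1)
    (hφ0 : φ p.1 ≠ 0) (hK : IsMetricAt K p.2) (V W : E₁ × E₂) :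
    ricciChart (warpedChart G φ K) p V W =
      ricciChart G p.1 V.1 W.1
        - Module.finrank ℝ E₂ / φ p.1 * hessianChart G φ p.1 V.1 W.1
        + ricciChart K p.2 V.2 W.2
        - K p.2 V.2 W.2 * (φ p.1 * laplacianChart G φ p.1
          + (Module.finrank ℝ E₂ - 1) * fderiv ℝ φ p.1 (gradientChart G φ p.1)) := by
  have := FiniteDimensional.complete ℝ E₁
  have := FiniteDimensional.complete ℝ E₂
  rw [ricciChart, trace_prod]
  have e1 : LinearMap.fst ℝ E₁ E₂ ∘ₗ (curvatureChart (warpedChart G φ K) p V W).toLinearMap ∘ₗ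
      LinearMap.inl ℝ E₁ E₂ = (curvatureChart G p.1 V.1 W.1).toLinearMap
        - (φ p.1 * K p.2 V.2 W.2) •
          ((G p.1).inverse ∘L hessianChart G φ p.1 : E₁ →L[ℝ] E₁).toLinearMap :=
    LinearMap.ext fun u => curvatureChart_warpedChart_fst hG hφ hφ0 hK V W u
  have e2 : LinearMap.snd ℝ E₁ E₂ ∘ₗ (curvatureChart (warpedChart G φ K) p V W).toLinearMap ∘ₗ
      LinearMap.inr ℝ E₁ E₂ = (curvatureChart K p.2 V.2 W.2).toLinearMap
        - (hessianChart G φ p.1 V.1 W.1 / φ p.1) • LinearMap.id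
        - fderiv ℝ φ p.1 (gradientChart G φ p.1) • (K p.2 V.2 W.2 • LinearMap.id
          - ((K p.2).flip W.2).toLinearMap.smulRight V.2) :=
    LinearMap.ext fun a => curvatureChart_warpedChart_snd hG hφ hφ0 hK V W a
  rw [e1, e2]
  -- The identity has trace `dim E₂` and the rank-one map `a ↦ K(a, W₂) V₂` has trace `K(V₂, W₂)`;
  -- their difference produces the factor `dim E₂ - 1`.
  simp only [map_sub, map_smul, LinearMap.trace_id, LinearMap.trace_smulRight, smul_eq_mul,
    ricciChart, laplacianChart, coe_coe, flip_apply]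
  ring

end WarpedCurvature


theorem two_le_infty : (2 : WithTop ℕ∞) ≤ ∞ := WithTop.coe_le_coe.2 le_top

/-! ### Unwarped products and functions that split as sums -/

section ProductVectorSpace

variable {E₁ : Type*} [NormedAddCommGroup E₁] [NormedSpace ℝ E₁]
  {E₂ : Type*} [NormedAddCommGroup E₂] [NormedSpace ℝ E₂]
  {G : E₁ → E₁ →L[ℝ] E₁ →L[ℝ] ℝ} {K : E₂ → E₂ →L[ℝ] E₂ →L[ℝ] ℝ} {p : E₁ × E₂}
  {φ : E₁ → ℝ} {ψ : E₂ → ℝ}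

theorem fderiv_add_fst_snd (hφ : DifferentiableAt ℝ φ p.1) (hψ : DifferentiableAt ℝ ψ p.2) :
    fderiv ℝ (fun x : E₁ × E₂ => φ x.1 + ψ x.2) p =
      fderiv ℝ φ p.1 ∘L fst ℝ E₁ E₂ + fderiv ℝ ψ p.2 ∘L snd ℝ E₁ E₂ :=
  ((hφ.hasFDerivAt.comp p hasFDerivAt_fst).add (hψ.hasFDerivAt.comp p hasFDerivAt_snd)).fderiv

theorem contDiffAt_add_fst_snd {n : WithTop ℕ∞} (hφ : ContDiffAt ℝ n φ p.1)
    (hψ : ContDiffAt ℝ n ψ p.2) : ContDiffAt ℝ n (fun x : E₁ × E₂ => φ x.1 + ψ x.2) p :=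
  (hφ.comp p contDiffAt_fst).add (hψ.comp p contDiffAt_snd)

theorem fderiv_fderiv_add_fst_snd (hφ : ContDiffAt ℝ 2 φ p.1) (hψ : ContDiffAt ℝ 2 ψ p.2)
    (U V : E₁ × E₂) :
    fderiv ℝ (fderiv ℝ (fun x : E₁ × E₂ => φ x.1 + ψ x.2)) p U V =
      fderiv ℝ (fderiv ℝ φ) p.1 U.1 V.1 + fderiv ℝ (fderiv ℝ ψ) p.2 U.2 V.2 := by
  have hdφ : DifferentiableAt ℝ (fderiv ℝ φ) p.1 :=
    (hφ.fderiv_right (m := 1) (by norm_num)).differentiableAt (by norm_num)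
  have hdψ : DifferentiableAt ℝ (fderiv ℝ ψ) p.2 :=
    (hψ.fderiv_right (m := 1) (by norm_num)).differentiableAt (by norm_num)
  have e : (fun x => fderiv ℝ (fun x : E₁ × E₂ => φ x.1 + ψ x.2) x V) =ᶠ[𝓝 p]
      fun x => fderiv ℝ φ x.1 V.1 + fderiv ℝ ψ x.2 V.2 := by
    filter_upwards [(continuous_fst.tendsto p).eventually (hφ.eventually (by simp)),
      (continuous_snd.tendsto p).eventually (hψ.eventually (by simp))] with x a b
    rw [fderiv_add_fst_snd (a.differentiableAt (by norm_num)) (b.differentiableAt (by norm_num))]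
    rfl
  have hd : DifferentiableAt ℝ (fderiv ℝ (fun x : E₁ × E₂ => φ x.1 + ψ x.2)) p :=
    ((contDiffAt_add_fst_snd hφ hψ).fderiv_right (m := 1) (by norm_num)).differentiableAt
      (by norm_num)
  have h1 := hd.hasFDerivAt.clm_apply (hasFDerivAt_const V p)
  have h2 := ((hdφ.hasFDerivAt.clm_apply (hasFDerivAt_const V.1 p.1)).comp p hasFDerivAt_fst).add
    ((hdψ.hasFDerivAt.clm_apply (hasFDerivAt_const V.2 p.2)).comp p hasFDerivAt_snd)
  simpa using congrArg (fun T : E₁ × E₂ →L[ℝ] ℝ => T U) (h1.unique (h2.congr_of_eventuallyEq e))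

/-- For the constant warping function `1` the connection decouples, and the second derivative of a
split sum has no mixed part. -/
theorem hessianChart_product (hG : IsMetricAt G p.1) (hK : IsMetricAt K p.2)
    (hφ : ContDiffAt ℝ 2 φ p.1) (hψ : ContDiffAt ℝ 2 ψ p.2) (U V : E₁ × E₂) :
    hessianChart (warpedChart G (fun _ => 1) K) (fun x : E₁ × E₂ => φ x.1 + ψ x.2) p U V =
      hessianChart G φ p.1 U.1 V.1 + hessianChart K ψ p.2 U.2 V.2 := by
  rw [hessianChart_apply, fderiv_fderiv_add_fst_snd hφ hψ,
    fderiv_add_fst_snd (hφ.differentiableAt (by norm_num)) (hψ.differentiableAt (by norm_num)),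
    christoffel_warpedChart hG contDiffAt_const one_ne_zero hK, hessianChart_apply,
    hessianChart_apply]
  simp [warpedConnection, gradientChart]
  ring

theorem gradientChart_product (hG : IsMetricAt G p.1) (hK : IsMetricAt K p.2)
    (hφ : DifferentiableAt ℝ φ p.1) (hψ : DifferentiableAt ℝ ψ p.2) :
    gradientChart (warpedChart G (fun _ => 1) K) (fun x : E₁ × E₂ => φ x.1 + ψ x.2) p =
      (gradientChart G φ p.1, gradientChart K ψ p.2) := by
  rw [gradientChart, (warpedChart_inverse_apply hG.invertible hK.invertible one_ne_zero _).2,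
    fderiv_add_fst_snd hφ hψ]
  have e1 : (fderiv ℝ φ p.1 ∘L fst ℝ E₁ E₂ + fderiv ℝ ψ p.2 ∘L snd ℝ E₁ E₂) ∘L inl ℝ E₁ E₂ =
      fderiv ℝ φ p.1 := by ext; simp
  have e2 : (fderiv ℝ φ p.1 ∘L fst ℝ E₁ E₂ + fderiv ℝ ψ p.2 ∘L snd ℝ E₁ E₂) ∘L inr ℝ E₁ E₂ =
      fderiv ℝ ψ p.2 := by ext; simp
  rw [e1, e2, one_pow, inv_one, one_smul]
  rfl

theorem laplacianChart_product [FiniteDimensional ℝ E₁] [FiniteDimensional ℝ E₂]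
    (hG : IsMetricAt G p.1) (hK : IsMetricAt K p.2)
    (hφ : ContDiffAt ℝ 2 φ p.1) (hψ : ContDiffAt ℝ 2 ψ p.2) :
    laplacianChart (warpedChart G (fun _ => 1) K) (fun x : E₁ × E₂ => φ x.1 + ψ x.2) p =
      laplacianChart G φ p.1 + laplacianChart K ψ p.2 := by
  rw [laplacianChart, trace_prod, laplacianChart, laplacianChart]
  congr 2
  · refine LinearMap.ext fun u => ?_
    have e : hessianChart (warpedChart G (fun _ => 1) K) (fun x : E₁ × E₂ => φ x.1 + ψ x.2) p (u, 0)
        ∘L inl ℝ E₁ E₂ = hessianChart G φ p.1 u := by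
      ext v; simp [hessianChart_product hG hK hφ hψ]
    refine (congrArg Prod.fst (warpedChart_inverse_apply (φ := fun _ => 1) hG.invertible
      hK.invertible one_ne_zero _).2).trans ?_
    exact congrArg (G p.1).inverse e
  · refine LinearMap.ext fun u => ?_
    have e : hessianChart (warpedChart G (fun _ => 1) K) (fun x : E₁ × E₂ => φ x.1 + ψ x.2) p (0, u)
        ∘L inr ℝ E₁ E₂ = hessianChart K ψ p.2 u := by
      ext v; simp [hessianChart_product hG hK hφ hψ]
    refine (congrArg Prod.snd (warpedChart_inverse_apply (φ := fun _ => 1) hG.invertible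
      hK.invertible one_ne_zero _).2).trans ?_
    simp only [one_pow, inv_one, one_smul]
    exact congrArg (K p.2).inverse e

/-- A constant warping function has zero differential and Hessian, so every correction term of the
warped formula drops out. -/
theorem ricciChart_product [FiniteDimensional ℝ E₁] [FiniteDimensional ℝ E₂]
    (hG : IsMetricAt G p.1) (hK : IsMetricAt K p.2) (V W : E₁ × E₂) :
    ricciChart (warpedChart G (fun _ => 1) K) p V W =
      ricciChart G p.1 V.1 W.1 + ricciChart K p.2 V.2 W.2 := by
  have hh : hessianChart G (fun _ => 1) p.1 = 0 := by
    ext u v; simp [hessianChart_apply]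
  rw [ricciChart_warpedChart hG contDiffAt_const one_ne_zero hK, laplacianChart, hh]
  simp

end ProductVectorSpace

/-! ### From manifolds to the preferred chart -/

section Manifold

/-- In finite dimension an injective map from a space to its dual is an isomorphism, since the
dimensions agree; injectivity survives pulling back along an invertible `A`. -/
theorem isInvertible_bilinearComp {E : Type*} [NormedAddCommGroup E] [NormedSpace ℝ E]
    [FiniteDimensional ℝ E] {B : E →L[ℝ] E →L[ℝ] ℝ} (hB : ∀ u, (∀ v, B u v = 0) → u = 0)
    {A : E →L[ℝ] E} (hA : A.IsInvertible) : (B.bilinearComp A A).IsInvertible := by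
  have hinj : Function.Injective (B.bilinearComp A A) := by
    rw [injective_iff_map_eq_zero]
    intro u hu
    refine hA.injective ((hB _ fun w => ?_).trans (map_zero A).symm)
    obtain ⟨v, rfl⟩ := hA.surjective w
    exact congrArg (fun T : E →L[ℝ] ℝ => T v) hu
  have hdim : Module.finrank ℝ E = Module.finrank ℝ (E →L[ℝ] ℝ) := by
    rw [← (LinearMap.toContinuousLinearMap (𝕜 := ℝ) (E := E) (F' := ℝ)).finrank_eq]
    exact (Subspace.dual_finrank_eq (K := ℝ) (V := E)).symm
  exact ⟨(LinearEquiv.ofInjectiveOfFinrankEq (B.bilinearComp A A).toLinearMap hinj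
    hdim).toContinuousLinearEquiv, by ext; rfl⟩

variable {E : Type*} [NormedAddCommGroup E] [NormedSpace ℝ E]
  {H : Type*} [TopologicalSpace H] {I : ModelWithCorners ℝ E H} [I.Boundaryless]
  {M : Type*} [TopologicalSpace M] [ChartedSpace H M] [IsManifold I ∞ M]

theorem isInvertible_mfderiv_extChartAt_symm_of_boundaryless {p : M} {x : E}
    (hx : x ∈ (extChartAt I p).target) :
    (mfderiv 𝓘(ℝ, E) I (extChartAt I p).symm x : E →L[ℝ] E).IsInvertible := by
  have : IsManifold I 1 M := .of_le (n := ∞) (by simp)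
  have h := isInvertible_mfderivWithin_extChartAt_symm hx
  rw [I.range_eq_univ, mfderivWithin_univ] at h
  exact h

theorem mdifferentiableAt_extChartAt_symm_of_boundaryless {p : M} {x : E}
    (hx : x ∈ (extChartAt I p).target) :
    MDifferentiableAt 𝓘(ℝ, E) I (extChartAt I p).symm x := by
  have : IsManifold I 1 M := .of_le (n := ∞) (by simp)
  have h := mdifferentiableWithinAt_extChartAt_symm hx
  rwa [I.range_eq_univ, mdifferentiableWithinAt_univ] at h

theorem IsPseudoRiemannianMetric.isMetricAt [FiniteDimensional ℝ E] {g : BilinearField I M}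
    (hg : IsPseudoRiemannianMetric g) {p : M} {x : E} (hx : x ∈ (extChartAt I p).target) :
    IsMetricAt (chartMetric g p) x where
  contDiffAt := ((hg.smooth p).contDiffAt ((isOpen_extChartAt_target p).mem_nhds hx)).of_le
    two_le_infty
  symm := .of_forall fun y u v => hg.symm ((extChartAt I p).symm y)
    (mfderiv 𝓘(ℝ, E) I (extChartAt I p).symm y u) (mfderiv 𝓘(ℝ, E) I (extChartAt I p).symm y v)
  invertible := isInvertible_bilinearComp (E := E) (hg.nondegenerate ((extChartAt I p).symm x))
    (isInvertible_mfderiv_extChartAt_symm_of_boundaryless hx)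

theorem chartMetric_self_eq (g : BilinearField I M) (p : M) :
    chartMetric g p (extChartAt I p p) = g p := by
  ext u v
  exact chartMetric_self g p u v

theorem laplacian_eq_laplacianChart (g : BilinearField I M) (φ : M → ℝ) (p : M) :
    laplacian g φ p =
      laplacianChart (chartMetric g p) (φ ∘ (extChartAt I p).symm) (extChartAt I p p) := by
  rw [laplacianChart, chartMetric_self_eq]
  rfl

theorem contDiffAt_comp_extChartAt_symm {φ : M → ℝ} (hφ : ContMDiff I 𝓘(ℝ, ℝ) ∞ φ) (p : M) :
    ContDiffAt ℝ 2 (φ ∘ (extChartAt I p).symm) (extChartAt I p p) := by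
  have h1 : ContMDiffAt 𝓘(ℝ, E) I ∞ (extChartAt I p).symm (extChartAt I p p) :=
    (contMDiffOn_extChartAt_symm p).contMDiffAt (extChartAt_target_mem_nhds p)
  exact (hφ.contMDiffAt.comp _ h1).contDiffAt.of_le two_le_infty

/-- Since `g(∇φ, ·) = dφ`, the square of the gradient is `dφ(∇φ)`, the form in which it occurs in
the Ricci formula. -/
theorem gradientSq_eq_gradientChart {g : BilinearField I M} {p : M}
    (hg : IsMetricAt (chartMetric g p) (extChartAt I p p)) {φ : M → ℝ}
    (hφ : MDifferentiableAt I 𝓘(ℝ, ℝ) φ p) :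
    gradientSq g φ p = fderiv ℝ (φ ∘ (extChartAt I p).symm) (extChartAt I p p)
      (gradientChart (chartMetric g p) (φ ∘ (extChartAt I p).symm) (extChartAt I p p)) := by
  have h1 : (mfderiv I 𝓘(ℝ, ℝ) φ p : E →L[ℝ] ℝ) =
      fderiv ℝ (φ ∘ (extChartAt I p).symm) (extChartAt I p p) := by
    rw [hφ.mfderiv, I.range_eq_univ]
    exact congrFun fderivWithin_univ _
  have h2 : (gradient g φ p : E) =
      gradientChart (chartMetric g p) (φ ∘ (extChartAt I p).symm) (extChartAt I p p) := by
    rw [gradientChart, chartMetric_self_eq, ← h1]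
    rfl
  have h3 : (show E →L[ℝ] E →L[ℝ] ℝ from g p).IsInvertible := by
    have := hg.invertible
    rwa [chartMetric_self_eq] at this
  rw [← h1, ← h2]
  exact congrArg (fun T : E →L[ℝ] ℝ => T (gradient g φ p)) (h3.self_apply_inverse _)

end Manifold


/-! ### Products and warped products of manifolds -/

section ProductManifold

variable {E₁ : Type*} [NormedAddCommGroup E₁] [NormedSpace ℝ E₁]
  {H₁ : Type*} [TopologicalSpace H₁] {I₁ : ModelWithCorners ℝ E₁ H₁}
  {M₁ : Type*} [TopologicalSpace M₁] [ChartedSpace H₁ M₁]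
  {E₂ : Type*} [NormedAddCommGroup E₂] [NormedSpace ℝ E₂]
  {H₂ : Type*} [TopologicalSpace H₂] {I₂ : ModelWithCorners ℝ E₂ H₂}
  {M₂ : Type*} [TopologicalSpace M₂] [ChartedSpace H₂ M₂]
  {g : BilinearField I₁ M₁} {h : BilinearField I₂ M₂} {p : M₁ × M₂}

variable {f₁ : M₁ → ℝ} {f₂ : M₂ → ℝ}

theorem contMDiff_splitSum (hf₁ : ContMDiff I₁ 𝓘(ℝ, ℝ) ∞ f₁) (hf₂ : ContMDiff I₂ 𝓘(ℝ, ℝ) ∞ f₂) :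
    ContMDiff (I₁.prod I₂) 𝓘(ℝ, ℝ) ∞ (splitSum f₁ f₂) :=
  (hf₁.comp contMDiff_fst).add (hf₂.comp contMDiff_snd)

variable [I₁.Boundaryless] [IsManifold I₁ ∞ M₁] [I₂.Boundaryless] [IsManifold I₂ ∞ M₂]

/-- The preferred chart of a product is the product chart, so the differential of its inverse is
block diagonal and pulls each factor back separately. -/
theorem chartMetric_warpedProduct (g : BilinearField I₁ M₁) (f : M₁ → ℝ) (h : BilinearField I₂ M₂)
    (p : M₁ × M₂) {x : E₁ × E₂} (hx₁ : x.1 ∈ (extChartAt I₁ p.1).target)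
    (hx₂ : x.2 ∈ (extChartAt I₂ p.2).target) :
    chartMetric (warpedProduct g f h) p x =
      warpedChart (chartMetric g p.1) (f ∘ (extChartAt I₁ p.1).symm) (chartMetric h p.2) x := by
  have hm : (mfderiv 𝓘(ℝ, E₁ × E₂) (I₁.prod I₂) (extChartAt (I₁.prod I₂) p).symm x :
        E₁ × E₂ →L[ℝ] E₁ × E₂) =
      ContinuousLinearMap.prodMap
        (show E₁ →L[ℝ] E₁ from mfderiv 𝓘(ℝ, E₁) I₁ (extChartAt I₁ p.1).symm x.1)
        (show E₂ →L[ℝ] E₂ from mfderiv 𝓘(ℝ, E₂) I₂ (extChartAt I₂ p.2).symm x.2) := by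
    have := mfderiv_prodMap (p := x) (mdifferentiableAt_extChartAt_symm_of_boundaryless hx₁)
      (mdifferentiableAt_extChartAt_symm_of_boundaryless hx₂)
    rw [modelWithCornersSelf_prod, ← chartedSpaceSelf_prod]
    exact this
  refine ContinuousLinearMap.ext fun u => ContinuousLinearMap.ext fun v => ?_
  rw [chartMetric_apply, hm]
  rfl

theorem eventually_chartMetric_warpedProduct (g : BilinearField I₁ M₁) (f : M₁ → ℝ)
    (h : BilinearField I₂ M₂) (p : M₁ × M₂) :
    chartMetric (warpedProduct g f h) p =ᶠ[𝓝 (extChartAt (I₁.prod I₂) p p)]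
      warpedChart (chartMetric g p.1) (f ∘ (extChartAt I₁ p.1).symm) (chartMetric h p.2) := by
  change _ =ᶠ[𝓝 (extChartAt I₁ p.1 p.1, extChartAt I₂ p.2 p.2)] _
  filter_upwards [(continuous_fst.tendsto _).eventually (extChartAt_target_mem_nhds (I := I₁) p.1),
    (continuous_snd.tendsto _).eventually (extChartAt_target_mem_nhds (I := I₂) p.2)]
    with x h1 h2 using chartMetric_warpedProduct g f h p h1 h2

theorem isMetricAt_warpedProduct {f : M₁ → ℝ}
    (hg : IsMetricAt (chartMetric g p.1) (extChartAt I₁ p.1 p.1))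
    (hf : ContMDiff I₁ 𝓘(ℝ, ℝ) ∞ f) (hf0 : f p.1 ≠ 0)
    (hh : IsMetricAt (chartMetric h p.2) (extChartAt I₂ p.2 p.2)) :
    IsMetricAt (chartMetric (warpedProduct g f h) p) (extChartAt (I₁.prod I₂) p p) :=
  (IsMetricAt.warpedChart (p := (extChartAt I₁ p.1 p.1, extChartAt I₂ p.2 p.2)) hg
    (contDiffAt_comp_extChartAt_symm hf p.1) (by simpa using hf0) hh).congr
    (eventually_chartMetric_warpedProduct g f h p)

theorem ricci_warpedProduct [FiniteDimensional ℝ E₁] [FiniteDimensional ℝ E₂] {f : M₁ → ℝ}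
    (hg : IsMetricAt (chartMetric g p.1) (extChartAt I₁ p.1 p.1))
    (hf : ContMDiff I₁ 𝓘(ℝ, ℝ) ∞ f) (hf0 : f p.1 ≠ 0)
    (hh : IsMetricAt (chartMetric h p.2) (extChartAt I₂ p.2 p.2))
    (V₁ W₁ : TangentSpace I₁ p.1) (V₂ W₂ : TangentSpace I₂ p.2) :
    ricci (warpedProduct g f h) p (V₁, V₂) (W₁, W₂) =
      ricci g p.1 V₁ W₁ - Module.finrank ℝ E₂ / f p.1 * hessian g f p.1 V₁ W₁
        + ricci h p.2 V₂ W₂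
        - h p.2 V₂ W₂ * (f p.1 * laplacian g f p.1
          + (Module.finrank ℝ E₂ - 1) * gradientSq g f p.1) := by
  rw [laplacian_eq_laplacianChart, gradientSq_eq_gradientChart hg (hf.mdifferentiableAt (by simp)),
    ← chartMetric_self h p.2]
  have hs : (f ∘ (extChartAt I₁ p.1).symm) (extChartAt I₁ p.1 p.1) = f p.1 := by simp
  rw [← hs] at hf0 ⊢
  exact (ricciChart_congr (eventually_chartMetric_warpedProduct g f h p) _ _).trans
    (ricciChart_warpedChart (p := (extChartAt I₁ p.1 p.1, extChartAt I₂ p.2 p.2)) hg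
      (contDiffAt_comp_extChartAt_symm hf p.1) hf0 hh (V₁, V₂) (W₁, W₂))

theorem ricci_productMetric [FiniteDimensional ℝ E₁] [FiniteDimensional ℝ E₂]
    (hg : IsMetricAt (chartMetric g p.1) (extChartAt I₁ p.1 p.1))
    (hh : IsMetricAt (chartMetric h p.2) (extChartAt I₂ p.2 p.2))
    (V₁ W₁ : TangentSpace I₁ p.1) (V₂ W₂ : TangentSpace I₂ p.2) :
    ricci (productMetric g h) p (V₁, V₂) (W₁, W₂) = ricci g p.1 V₁ W₁ + ricci h p.2 V₂ W₂ :=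
  (ricciChart_congr (eventually_chartMetric_warpedProduct g _ h p) _ _).trans
    (ricciChart_product (p := (extChartAt I₁ p.1 p.1, extChartAt I₂ p.2 p.2)) hg hh
      (V₁, V₂) (W₁, W₂))

theorem hessian_productMetric
    (hg : IsMetricAt (chartMetric g p.1) (extChartAt I₁ p.1 p.1))
    (hh : IsMetricAt (chartMetric h p.2) (extChartAt I₂ p.2 p.2))
    (hf₁ : ContMDiff I₁ 𝓘(ℝ, ℝ) ∞ f₁) (hf₂ : ContMDiff I₂ 𝓘(ℝ, ℝ) ∞ f₂)
    (V₁ W₁ : TangentSpace I₁ p.1) (V₂ W₂ : TangentSpace I₂ p.2) :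
    hessian (productMetric g h) (splitSum f₁ f₂) p (V₁, V₂) (W₁, W₂) =
      hessian g f₁ p.1 V₁ W₁ + hessian h f₂ p.2 V₂ W₂ :=
  (congrArg (fun T : E₁ × E₂ →L[ℝ] E₁ × E₂ →L[ℝ] ℝ => T (V₁, V₂) (W₁, W₂))
    (hessianChart_congr (eventually_chartMetric_warpedProduct g _ h p) _)).trans
    (hessianChart_product (p := (extChartAt I₁ p.1 p.1, extChartAt I₂ p.2 p.2)) hg hh
      (contDiffAt_comp_extChartAt_symm hf₁ p.1) (contDiffAt_comp_extChartAt_symm hf₂ p.2)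
      (V₁, V₂) (W₁, W₂))

theorem laplacian_productMetric [FiniteDimensional ℝ E₁] [FiniteDimensional ℝ E₂]
    (hg : IsMetricAt (chartMetric g p.1) (extChartAt I₁ p.1 p.1))
    (hh : IsMetricAt (chartMetric h p.2) (extChartAt I₂ p.2 p.2))
    (hf₁ : ContMDiff I₁ 𝓘(ℝ, ℝ) ∞ f₁) (hf₂ : ContMDiff I₂ 𝓘(ℝ, ℝ) ∞ f₂) :
    laplacian (productMetric g h) (splitSum f₁ f₂) p = laplacian g f₁ p.1 + laplacian h f₂ p.2 := by
  have e := eventually_chartMetric_warpedProduct g (fun _ => 1) h p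
  simp only [laplacian_eq_laplacianChart]
  rw [← laplacianChart_product (p := (extChartAt I₁ p.1 p.1, extChartAt I₂ p.2 p.2)) hg hh
      (contDiffAt_comp_extChartAt_symm hf₁ p.1) (contDiffAt_comp_extChartAt_symm hf₂ p.2)]
  rw [laplacianChart, laplacianChart, productMetric, e.eq_of_nhds,
    hessianChart_congr e]
  -- The product chart carries the split sum to the sum of the two coordinate expressions by
  -- definition.
  rfl

theorem isMetricAt_productMetric
    (hg : IsMetricAt (chartMetric g p.1) (extChartAt I₁ p.1 p.1))
    (hh : IsMetricAt (chartMetric h p.2) (extChartAt I₂ p.2 p.2)) :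
    IsMetricAt (chartMetric (productMetric g h) p) (extChartAt (I₁.prod I₂) p p) :=
  isMetricAt_warpedProduct hg contMDiff_const one_ne_zero hh

theorem gradientSq_productMetric
    (hg : IsMetricAt (chartMetric g p.1) (extChartAt I₁ p.1 p.1))
    (hh : IsMetricAt (chartMetric h p.2) (extChartAt I₂ p.2 p.2))
    (hf₁ : ContMDiff I₁ 𝓘(ℝ, ℝ) ∞ f₁) (hf₂ : ContMDiff I₂ 𝓘(ℝ, ℝ) ∞ f₂) :
    gradientSq (productMetric g h) (splitSum f₁ f₂) p =
      gradientSq g f₁ p.1 + gradientSq h f₂ p.2 := by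
  have e := eventually_chartMetric_warpedProduct g (fun _ => 1) h p
  rw [gradientSq_eq_gradientChart (isMetricAt_productMetric hg hh)
      ((contMDiff_splitSum hf₁ hf₂).mdifferentiableAt (by simp)),
    gradientSq_eq_gradientChart hg (hf₁.mdifferentiableAt (by simp)),
    gradientSq_eq_gradientChart hh (hf₂.mdifferentiableAt (by simp))]
  have d1 := (contDiffAt_comp_extChartAt_symm hf₁ p.1).differentiableAt (by norm_num)
  have d2 := (contDiffAt_comp_extChartAt_symm hf₂ p.2).differentiableAt (by norm_num)
  have h1 := gradientChart_product (p := (extChartAt I₁ p.1 p.1, extChartAt I₂ p.2 p.2)) hg hh d1 d2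
  have h2 := fderiv_add_fst_snd (p := (extChartAt I₁ p.1 p.1, extChartAt I₂ p.2 p.2)) d1 d2
  have h3 : gradientChart (chartMetric (productMetric g h) p)
      (splitSum f₁ f₂ ∘ (extChartAt (I₁.prod I₂) p).symm) (extChartAt (I₁.prod I₂) p p) =
      (gradientChart (chartMetric g p.1) (f₁ ∘ (extChartAt I₁ p.1).symm) (extChartAt I₁ p.1 p.1),
        gradientChart (chartMetric h p.2) (f₂ ∘ (extChartAt I₂ p.2).symm)
          (extChartAt I₂ p.2 p.2)) := by
    rw [← h1, gradientChart, gradientChart, productMetric, e.eq_of_nhds]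
    rfl
  rw [h3]
  exact congrArg (fun T : E₁ × E₂ →L[ℝ] ℝ => T _) h2

end ProductManifold

/-! ### The flat fiber -/

theorem isMetricAt_derivedFlat {d : ℕ} (F : DerivedFlat d) (q : F.Underlying) :
    IsMetricAt (chartMetric F.metric q) (extChartAt 𝓘(ℝ, Eucl d) q q) := by
  -- The preferred chart of `ℝ^d` is the identity, so the metric is constant in it.
  have hc : chartMetric F.metric q = fun _ => (-(innerSL ℝ) : Eucl d →L[ℝ] Eucl d →L[ℝ] ℝ) := by
    have hm (x : Eucl d) : (mfderiv 𝓘(ℝ, Eucl d) 𝓘(ℝ, Eucl d) (extChartAt 𝓘(ℝ, Eucl d) q).symm x :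
        Eucl d →L[ℝ] Eucl d) = .id ℝ (Eucl d) := by
      rw [extChartAt_model_space_eq_id]
      exact mfderiv_id
    refine funext fun x => ContinuousLinearMap.ext fun u => ContinuousLinearMap.ext fun v => ?_
    rw [chartMetric_apply, hm]
    rfl
  rw [hc]
  refine ⟨contDiffAt_const, .of_forall fun _ u v => ?_, ?_⟩
  · exact congrArg Neg.neg (real_inner_comm v u)
  · have := isInvertible_bilinearComp (B := (-(innerSL ℝ) : Eucl d →L[ℝ] Eucl d →L[ℝ] ℝ))
      (fun u hu => inner_self_eq_zero.1 (neg_eq_zero.1 (hu u)))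
      (A := .id ℝ (Eucl d)) ⟨.refl ℝ _, rfl⟩
    exact this

/-! ### Vanishing of tensors on zero arguments, for evaluation on blocks -/

section Zero

variable {E : Type*} [NormedAddCommGroup E] [NormedSpace ℝ E]
  {H : Type*} [TopologicalSpace H] {I : ModelWithCorners ℝ E H}
  {M : Type*} [TopologicalSpace M] [ChartedSpace H M]

theorem ricci_zero_left (g : BilinearField I M) (p : M) (w : TangentSpace I p) :
    ricci g p 0 w = 0 := ricciChart_zero_left _ _ _

theorem ricci_zero_right (g : BilinearField I M) (p : M) (v : TangentSpace I p) :
    ricci g p v 0 = 0 := ricciChart_zero_right _ _ _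

theorem bilinearField_zero_left (g : BilinearField I M) (p : M) (w : TangentSpace I p) :
    g p 0 w = 0 := by rw [map_zero]; rfl

theorem bilinearField_zero_right (g : BilinearField I M) (p : M) (v : TangentSpace I p) :
    g p v 0 = 0 := map_zero _

theorem laplacian_eq_zero {g : BilinearField I M} {φ : M → ℝ} {p : M} (h : hessian g φ p = 0) :
    laplacian g φ p = 0 := by
  have e : hessianChart (E := E) (chartMetric g p) (φ ∘ (extChartAt I p).symm)
    (extChartAt I p p) = 0 := h
  change LinearMap.trace ℝ E (((show E →L[ℝ] E →L[ℝ] ℝ from g p).inverse ∘L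
    hessianChart (E := E) (chartMetric g p) (φ ∘ (extChartAt I p).symm) (extChartAt I p p) :
      E →L[ℝ] E) : E →ₗ[ℝ] E) = 0
  rw [e, comp_zero]
  exact map_zero _

end Zero

end WarpedRicci

/-! ### The block formulas and the PNDP condition -/

theorem mainTheorem1
    {E₁ : Type*} [NormedAddCommGroup E₁] [NormedSpace ℝ E₁] [FiniteDimensional ℝ E₁]
    {H₁ : Type*} [TopologicalSpace H₁] (I₁ : ModelWithCorners ℝ E₁ H₁) [I₁.Boundaryless]
    {B₁ : Type*} [TopologicalSpace B₁] [ChartedSpace H₁ B₁] [IsManifold I₁ ∞ B₁]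
    [Nonempty B₁]
    {E₂ : Type*} [NormedAddCommGroup E₂] [NormedSpace ℝ E₂] [FiniteDimensional ℝ E₂]
    {H₂ : Type*} [TopologicalSpace H₂] (I₂ : ModelWithCorners ℝ E₂ H₂) [I₂.Boundaryless]
    {B₂ : Type*} [TopologicalSpace B₂] [ChartedSpace H₂ B₂] [IsManifold I₂ ∞ B₂]
    (g₁ : WarpedRicci.BilinearField I₁ B₁) (hg₁ : WarpedRicci.IsPseudoRiemannianMetric g₁)
    (g₂ : WarpedRicci.BilinearField I₂ B₂) (hg₂ : WarpedRicci.IsPseudoRiemannianMetric g₂)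
    (f₁ : B₁ → ℝ) (hf₁ : ContMDiff I₁ 𝓘(ℝ, ℝ) ∞ f₁)
    (f₂ : B₂ → ℝ) (hf₂ : ContMDiff I₂ 𝓘(ℝ, ℝ) ∞ f₂)
    (hpos : ∀ b : B₁ × B₂, 0 < WarpedRicci.splitSum f₁ f₂ b)
    {d : ℕ} (F : WarpedRicci.DerivedFlat d) :
    let g : WarpedRicci.BilinearField (I₁.prod I₂) (B₁ × B₂) := WarpedRicci.productMetric g₁ g₂
    let f : B₁ × B₂ → ℝ := WarpedRicci.splitSum f₁ f₂
    let gbar : WarpedRicci.BilinearField ((I₁.prod I₂).prod 𝓘(ℝ, WarpedRicci.Eucl d))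
      ((B₁ × B₂) × F.Underlying) := WarpedRicci.totalMetric g₁ g₂ f₁ f₂ F
    -- the Hessian, the gradient and the Laplacian of `f` split
    (∀ (b : B₁ × B₂) (X₁ Y₁ : TangentSpace I₁ b.1) (X₂ Y₂ : TangentSpace I₂ b.2),
      WarpedRicci.hessian g f b (X₁, X₂) (Y₁, Y₂) =
        WarpedRicci.hessian g₁ f₁ b.1 X₁ Y₁ + WarpedRicci.hessian g₂ f₂ b.2 X₂ Y₂) ∧
    (∀ b : B₁ × B₂, WarpedRicci.gradientSq g f b =
      WarpedRicci.gradientSq g₁ f₁ b.1 + WarpedRicci.gradientSq g₂ f₂ b.2) ∧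
    (∀ b : B₁ × B₂, WarpedRicci.laplacian g f b =
      WarpedRicci.laplacian g₁ f₁ b.1 + WarpedRicci.laplacian g₂ f₂ b.2) ∧
    -- the first block
    (∀ (b : B₁ × B₂) (q : F.Underlying) (X₁ Y₁ : TangentSpace I₁ b.1),
      WarpedRicci.ricci gbar (b, q) ((X₁, 0), 0) ((Y₁, 0), 0) =
        WarpedRicci.ricci g₁ b.1 X₁ Y₁ - d / f b * WarpedRicci.hessian g₁ f₁ b.1 X₁ Y₁) ∧
    -- the mixed terms
    (∀ (b : B₁ × B₂) (q : F.Underlying) (X₁ : TangentSpace I₁ b.1) (X₂ : TangentSpace I₂ b.2),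
      WarpedRicci.ricci gbar (b, q) ((X₁, 0), 0) ((0, X₂), 0) = 0) ∧
    (∀ (b : B₁ × B₂) (q : F.Underlying) (X₁ : TangentSpace I₁ b.1) (X₂ : TangentSpace I₂ b.2)
      (U : TangentSpace 𝓘(ℝ, WarpedRicci.Eucl d) q),
      WarpedRicci.ricci gbar (b, q) ((X₁, X₂), 0) ((0, 0), U) = 0) ∧
    -- the Hessian of `f₂` vanishes as soon as the manifold is a PNDP-manifold
    (∀ lam : ℝ, WarpedRicci.IsPNDP g₁ g₂ f₁ f₂ F lam →
      ∀ y : B₂, WarpedRicci.hessian g₂ f₂ y = 0) ∧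
    -- if the Hessian of `f₂` vanishes: the Laplacian of `f₂`, the second block and the fiber block
    ((∀ y : B₂, WarpedRicci.hessian g₂ f₂ y = 0) →
      (∀ y : B₂, WarpedRicci.laplacian g₂ f₂ y = 0) ∧
      (∀ (b : B₁ × B₂) (q : F.Underlying) (X₂ Y₂ : TangentSpace I₂ b.2),
        WarpedRicci.ricci gbar (b, q) ((0, X₂), 0) ((0, Y₂), 0) =
          WarpedRicci.ricci g₂ b.2 X₂ Y₂) ∧
      (∀ (b : B₁ × B₂) (q : F.Underlying) (U V : TangentSpace 𝓘(ℝ, WarpedRicci.Eucl d) q),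
        WarpedRicci.ricci gbar (b, q) ((0, 0), U) ((0, 0), V) =
          WarpedRicci.ricci F.metric q U V - f b ^ 2 * F.metric q U V *
            (WarpedRicci.laplacian g₁ f₁ b.1 / f b +
              ((d : ℝ) - 1) * (WarpedRicci.gradientSq g f b / f b ^ 2)))) := by
  intro g f gbar
  have hm₁ : ∀ x, WarpedRicci.IsMetricAt (WarpedRicci.chartMetric g₁ x) (extChartAt I₁ x x) :=
    fun x => hg₁.isMetricAt (mem_extChartAt_target x)
  have hm₂ : ∀ y, WarpedRicci.IsMetricAt (WarpedRicci.chartMetric g₂ y) (extChartAt I₂ y y) :=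
    fun y => hg₂.isMetricAt (mem_extChartAt_target y)
  have hhess := fun (b : B₁ × B₂) => WarpedRicci.hessian_productMetric (hm₁ b.1) (hm₂ b.2) hf₁ hf₂
  have hgrad := fun (b : B₁ × B₂) =>
    WarpedRicci.gradientSq_productMetric (hm₁ b.1) (hm₂ b.2) hf₁ hf₂
  have hlap : ∀ b, WarpedRicci.laplacian g f b =
      WarpedRicci.laplacian g₁ f₁ b.1 + WarpedRicci.laplacian g₂ f₂ b.2 := fun b =>
    WarpedRicci.laplacian_productMetric (hm₁ b.1) (hm₂ b.2) hf₁ hf₂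
  -- The master formula: the warped formula over the base `B₁ × B₂`, with the base Ricci tensor and
  -- the Hessian of `f` split. Every Ricci statement below inserts zeros into it.
  have hric : ∀ (b : B₁ × B₂) (q : F.Underlying) (X₁ Y₁ : TangentSpace I₁ b.1)
      (X₂ Y₂ : TangentSpace I₂ b.2) (U V : TangentSpace 𝓘(ℝ, WarpedRicci.Eucl d) q),
      WarpedRicci.ricci gbar (b, q) ((X₁, X₂), U) ((Y₁, Y₂), V) =
        WarpedRicci.ricci g₁ b.1 X₁ Y₁ + WarpedRicci.ricci g₂ b.2 X₂ Y₂
          - d / f b * (WarpedRicci.hessian g₁ f₁ b.1 X₁ Y₁ + WarpedRicci.hessian g₂ f₂ b.2 X₂ Y₂)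
          + WarpedRicci.ricci F.metric q U V
          - F.metric q U V * (f b * WarpedRicci.laplacian g f b
            + (d - 1) * WarpedRicci.gradientSq g f b) := by
    intro b q X₁ Y₁ X₂ Y₂ U V
    have h := WarpedRicci.ricci_warpedProduct (p := (b, q))
      (WarpedRicci.isMetricAt_productMetric (hm₁ b.1) (hm₂ b.2))
      (WarpedRicci.contMDiff_splitSum hf₁ hf₂) (hpos b).ne' (WarpedRicci.isMetricAt_derivedFlat F q)
      (X₁, X₂) (Y₁, Y₂) U V
    rw [finrank_euclideanSpace_fin] at h
    rw [← hhess, ← WarpedRicci.ricci_productMetric (hm₁ b.1) (hm₂ b.2)]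
    exact h
  refine ⟨hhess, hgrad, hlap, fun b q X₁ Y₁ => ?_, fun b q X₁ X₂ => ?_, fun b q X₁ X₂ U => ?_,
    fun lam hP y => ?_, fun hz => ?_⟩
  · refine (hric b q X₁ Y₁ 0 0 0 0).trans ?_
    rw [WarpedRicci.ricci_zero_left, WarpedRicci.ricci_zero_left,
      WarpedRicci.bilinearField_zero_left, WarpedRicci.bilinearField_zero_left]
    ring
  · refine (hric b q X₁ 0 0 X₂ 0 0).trans ?_
    rw [WarpedRicci.ricci_zero_left, WarpedRicci.ricci_zero_right,
      WarpedRicci.ricci_zero_left, WarpedRicci.bilinearField_zero_right,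
      WarpedRicci.bilinearField_zero_left, WarpedRicci.bilinearField_zero_left]
    ring
  · refine (hric b q X₁ 0 X₂ 0 0 U).trans ?_
    rw [WarpedRicci.ricci_zero_right, WarpedRicci.ricci_zero_right,
      WarpedRicci.ricci_zero_left, WarpedRicci.bilinearField_zero_right,
      WarpedRicci.bilinearField_zero_right, WarpedRicci.bilinearField_zero_left]
    ring
  -- A point of `B₁` is needed to place `y` in the total space, where the Einstein equation is
  -- available. The fiber point can be arbitrary and is taken to be `0`.
  · obtain ⟨x⟩ := ‹Nonempty B₁›
    refine ContinuousLinearMap.ext fun X₂ => ContinuousLinearMap.ext fun Y₂ => ?_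
    -- The virtual dimension is both negative and equal to `-d`.
    have hd : (d : ℝ) ≠ 0 := by
      have h1 := hP.virtualDim_neg
      rw [hP.virtualDim_eq] at h1
      exact_mod_cast (by omega : d ≠ 0)
    -- The factor `1 ^ 2` appears because the product metric is by definition the warped product
    -- with function `1`.
    have hE : WarpedRicci.ricci gbar ((x, y), 0) ((0, X₂), 0) ((0, Y₂), 0) =
        lam * (g₁ x 0 0 + 1 ^ 2 * g₂ y X₂ Y₂ + f (x, y) ^ 2 * F.metric 0 0 0) :=
      hP.einstein_total ((x, y), 0) ((0, X₂), 0) ((0, Y₂), 0)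
    have h := hE.symm.trans (hric (x, y) 0 0 0 X₂ Y₂ 0 0)
    rw [hP.einstein_second, WarpedRicci.ricci_zero_left, WarpedRicci.ricci_zero_left,
      WarpedRicci.bilinearField_zero_left, WarpedRicci.bilinearField_zero_left,
      WarpedRicci.bilinearField_zero_left] at h
    -- The terms `lam * g₂` on the two sides cancel because both Einstein constants are the same.
    have h3 : d / f (x, y) * WarpedRicci.hessian g₂ f₂ y X₂ Y₂ = 0 := by linarith
    exact (mul_eq_zero.1 h3).resolve_left (div_ne_zero hd (hpos (x, y)).ne')
  · have hl : ∀ y, WarpedRicci.laplacian g₂ f₂ y = 0 :=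
      fun y => WarpedRicci.laplacian_eq_zero (hz y)
    refine ⟨hl, fun b q X₂ Y₂ => ?_, fun b q U V => ?_⟩
    · refine (hric b q 0 0 X₂ Y₂ 0 0).trans ?_
      rw [hz, WarpedRicci.ricci_zero_left, WarpedRicci.ricci_zero_left,
        WarpedRicci.bilinearField_zero_left, WarpedRicci.bilinearField_zero_left]
      simp
    · refine (hric b q 0 0 0 0 U V).trans ?_
      rw [hz, WarpedRicci.ricci_zero_left, WarpedRicci.ricci_zero_left,
        WarpedRicci.bilinearField_zero_left, hlap, hl]
      have hf0 : f b ≠ 0 := (hpos b).ne'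
      simp only [zero_apply]
      -- With the Laplacian of `f₂` gone, the claim is `f Δ'f' + (d - 1)|∇f|² = f² f^*`, which only
      -- needs `f` to be nonzero.
      field_simp
      ring
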